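/- Let $p$ be an odd prime, let $m$ be an integer whose residue class generates $(\mathbb{Z}/p)^\times$, and let $G=G(p,p-1)=\langle x,y\mid x^p=1,\ y^{p-1}=1,\ yx=x^my\rangle$ and $\Lambda=\mathbb{Z}[G]$. Modules are right $\Lambda$-modules. Let $\mathbb{Z}[C_{p-1}]$, where $C_{p-1}=\langle y\rangle$, be the $\Lambda$-module obtained through the ring homomorphism $\varepsilon:\Lambda\to\mathbb{Z}[C_{p-1}]$ with $x\mapsto 1$, $y\mapsto y$. Let $\mathcal{T}$ be the ring of $(p-1)\times(p-1)$ integral matrices whose entries below the diagonal are divisible by $p$. Let $\zeta$ be a primitive $p$-th root of unity and let $\tilde\lambda:\Lambda\to\mathcal{T}$ be the ring homomorphism which sends $x$ and $y$ to the matrices of multiplication by $\zeta$ and of the Galois automorphism $\zeta\mapsto\zeta^m$ of $\mathbb{Z}[\zeta]$, respectively, with respect to the basis $(\zeta-1)^{p-2},\dots,\zeta-1,1$. Let $R(i)$, $1\le i\le p-1$, be the $i$-th row of $\mathcal{T}$, i.e. the lattice of row vectors $v\in\mathbb{Z}^{p-1}$ with $v_j\in p\mathbb{Z}$ for $j<i$,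 on which $\Lambda$ acts from the right through $\tilde\lambda$. For $1\le n\le p-1$ put $R(\hat n)=\bigoplus_{i\ne n}R(i)$. For a $\Lambda$-homomorphism $f:\bigoplus_{i=1}^{p-1}R(i)\to R(\hat n)$ and $i\neq n$, the component $R(i)\to R(i)$ of $f$ is multiplication by an integer $f_i$; the classes $f_i+p\mathbb{Z}$, $i\ne n$, are called the $k$-invariants of $f$. An extension $0\to R(\hat n)\to K\to\mathbb{Z}[C_{p-1}]\to 0$ of $\Lambda$-modules is said to have all non-zero $k$-invariants if it is congruent to the pushout $f_*(\Psi)$ of a short exact sequence of $\Lambda$-modules $$\Psi=\Bigl(0\to\bigoplus_{i=1}^{p-1}R(i)\xrightarrow{\,j\,}\Lambda\xrightarrow{\,\varepsilon\,}\mathbb{Z}[C_{p-1}]\to0\Bigr)$$ along some $\Lambda$-homomorphism $f:\bigoplus_{i=1}^{p-1}R(i)\to R(\hat n)$ all of whose $k$-invariants are non-zero. Theorem. Let $1\le n\le p-1$. For every extension $$0\to R(\hat n)\to K\to\mathbb{Z}[C_{p-1}]\to0$$ of $\Lambda$-modules with all non-zero $k$-invariants there is an injective $\Lambda$-homomorphism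 $i:R(n)\to\Lambda$ such that $K\cong\Lambda/i(R(n))$ as $\Lambda$-modules. -/

import Mathlib

noncomputable section

namespace Metacyclic

open Polynomial

section TheGroup

variable (p : ℕ) [Fact p.Prime]

/-- The cyclic group `C_{p-1}`, written multiplicatively. -/
abbrev CycQ := Multiplicative (ZMod (p - 1))

/-- The cyclic group `C_p`, written multiplicatively. -/
abbrev CycP := Multiplicative (ZMod p)

/-- A unit `u` mod `p` acts on `C_p` by `x ↦ x ^ u`. -/
def powAut : (ZMod p)ˣ →* MulAut (CycP p) where
  toFun u :=
    { toFun := fun a => Multiplicative.ofAdd ((u : ZMod p) * a.toAdd)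
      invFun := fun a => Multiplicative.ofAdd (((u⁻¹ : (ZMod p)ˣ) : ZMod p) * a.toAdd)
      left_inv := fun a => by
        rw [← ofAdd_toAdd a]
        simp only [toAdd_ofAdd]
        rw [← mul_assoc, Units.inv_mul, one_mul]
      right_inv := fun a => by
        rw [← ofAdd_toAdd a]
        simp only [toAdd_ofAdd]
        rw [← mul_assoc, Units.mul_inv, one_mul]
      map_mul' := fun a b => by rw [toAdd_mul, mul_add, ofAdd_add] }
  map_one' := MulEquiv.ext fun a => congrArg Multiplicative.ofAdd (one_mul a.toAdd)
  map_mul' u v := MulEquiv.ext fun a =>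
    congrArg Multiplicative.ofAdd (mul_assoc (u : ZMod p) (v : ZMod p) a.toAdd)

lemma toAdd_powAut (u : (ZMod p)ˣ) (a : CycP p) : (powAut p u a).toAdd = u * a.toAdd := rfl

/-- The homomorphism `C_{p-1} → (ℤ/p)ˣ` sending the generator `y` to `m`. -/
def unitHom (m : (ZMod p)ˣ) : CycQ p →* (ZMod p)ˣ where
  toFun k := m ^ k.toAdd.val
  map_one' := by simp
  map_mul' k l := by
    have : NeZero (p - 1) :=
      ⟨Nat.sub_ne_zero_of_lt (Fact.out : p.Prime).one_lt⟩
    rw [toAdd_mul, ZMod.val_add, ← pow_add]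
    exact (pow_eq_pow_mod _ (ZMod.units_pow_card_sub_one_eq_one p m)).symm

/-- The metacyclic group `⟨x, y ∣ x ^ p = 1, y ^ (p - 1) = 1, y x = x ^ m y⟩`, realised as the
semidirect product of `C_p = ⟨x⟩` by `C_{p-1} = ⟨y⟩`, where `y` acts by `x ↦ x ^ m`. It is
`G(p, p - 1)` when `m` has order `p - 1`. -/
abbrev Grp (m : (ZMod p)ˣ) := CycP p ⋊[(powAut p).comp (unitHom p m)] CycQ p

/-- The integral group ring `Λ`. Right `Λ`-modules are modules over its opposite ring. -/
abbrev GrpRing (m : (ZMod p)ˣ) := MonoidAlgebra ℤ (Grp p m)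

end TheGroup

section Cyclotomic

variable (p : ℕ) [Fact p.Prime]

/-- The minimal polynomial of `ζ - 1`, `ζ` a primitive `p`-th root of unity. -/
def shiftPoly : ℤ[X] := (cyclotomic p ℤ).comp (X + 1)

lemma shiftPoly_monic : (shiftPoly p).Monic := by
  have h : (X + 1 : ℤ[X]) = X + C 1 := by simp
  rw [shiftPoly, h]
  exact (cyclotomic.monic p ℤ).comp_X_add_C 1

lemma shiftPoly_natDegree : (shiftPoly p).natDegree = p - 1 := by
  have h : (X + 1 : ℤ[X]) = X + C 1 := by simp
  rw [shiftPoly, h, natDegree_comp, natDegree_X_add_C, mul_one, natDegree_cyclotomic,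
    Nat.totient_prime Fact.out]

lemma aeval_shiftPoly {S : Type*} [CommRing S] [Algebra ℤ S] (s : S) :
    aeval s (shiftPoly p) = aeval (s + 1) (cyclotomic p ℤ) := by
  rw [shiftPoly, aeval_comp]
  simp

/-- The ring `ℤ[ζ]` of cyclotomic integers, presented by the generator `ζ - 1`. -/
abbrev CycInt := AdjoinRoot (shiftPoly p)

/-- The element `ζ - 1`. -/
def piElt : CycInt p := AdjoinRoot.root (shiftPoly p)

/-- The primitive `p`-th root of unity `ζ`. -/
def zeta : CycInt p := piElt p + 1

lemma aeval_zeta : aeval (zeta p) (cyclotomic p ℤ) = 0 := by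
  have h : aeval (piElt p) (shiftPoly p) = 0 := by
    rw [piElt, AdjoinRoot.aeval_eq, AdjoinRoot.mk_self]
  rwa [aeval_shiftPoly] at h

lemma sum_zeta : ∑ i ∈ Finset.range p, zeta p ^ i = 0 := by
  have h := aeval_zeta p
  rw [cyclotomic_prime] at h
  simpa using h

lemma zeta_pow : zeta p ^ p = 1 := by
  have h := geom_sum_mul (zeta p) p
  rw [sum_zeta, zero_mul] at h
  exact (sub_eq_zero.mp h.symm)

/-- `ζ ^ a` for an exponent `a` mod `p`. -/
def zetaPow (a : ZMod p) : CycInt p := zeta p ^ a.val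

lemma zetaPow_natCast (k : ℕ) : zetaPow p (k : ZMod p) = zeta p ^ k := by
  rw [zetaPow, ZMod.val_natCast]
  exact (pow_eq_pow_mod _ (zeta_pow p)).symm

lemma zetaPow_add (a b : ZMod p) : zetaPow p (a + b) = zetaPow p a * zetaPow p b := by
  rw [zetaPow, zetaPow, zetaPow, ZMod.val_add, ← pow_add]
  exact (pow_eq_pow_mod _ (zeta_pow p)).symm

lemma zetaPow_zero : zetaPow p 0 = 1 := by simp [zetaPow]

lemma zetaPow_pow (a : ZMod p) (k : ℕ) : zetaPow p a ^ k = zetaPow p (a * k) := by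
  rw [zetaPow, ← pow_mul, ← zetaPow_natCast]
  simp

lemma sum_zetaPow : ∑ a : ZMod p, zetaPow p a = 0 := by
  rw [← sum_zeta p]
  refine Finset.sum_nbij' ZMod.val (fun k : ℕ => (k : ZMod p)) ?_ ?_ ?_ ?_ ?_
  · exact fun a _ => Finset.mem_range.2 (ZMod.val_lt a)
  · exact fun _ _ => Finset.mem_univ _
  · exact fun a _ => ZMod.natCast_zmod_val a
  · exact fun k hk => ZMod.val_cast_of_lt (Finset.mem_range.1 hk)
  · exact fun _ _ => rfl

lemma eval_conj (u : (ZMod p)ˣ) :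
    (shiftPoly p).eval₂ (Algebra.ofId ℤ (CycInt p) : ℤ →+* CycInt p) (zetaPow p u - 1) = 0 := by
  change aeval (zetaPow p u - 1) (shiftPoly p) = 0
  have h : aeval (zetaPow p u - 1) (shiftPoly p) = aeval (zetaPow p u) (cyclotomic p ℤ) := by
    rw [aeval_shiftPoly, sub_add_cancel]
  rw [h, cyclotomic_prime]
  simp only [aeval_X, map_sum, map_pow]
  rw [← sum_zetaPow p]
  symm
  refine Finset.sum_nbij' (fun a : ZMod p => (((u⁻¹ : (ZMod p)ˣ) : ZMod p) * a).val)
    (fun k : ℕ => (u : ZMod p) * (k : ZMod p)) ?_ ?_ ?_ ?_ ?_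
  · exact fun a _ => Finset.mem_range.2 (ZMod.val_lt _)
  · exact fun _ _ => Finset.mem_univ _
  · exact fun a _ => by rw [ZMod.natCast_zmod_val, ← mul_assoc, Units.mul_inv, one_mul]
  · exact fun k hk => by
      rw [← mul_assoc, Units.inv_mul, one_mul]
      exact ZMod.val_cast_of_lt (Finset.mem_range.1 hk)
  · exact fun a _ => by
      rw [zetaPow_pow, ZMod.natCast_zmod_val, ← mul_assoc, Units.mul_inv, one_mul]

/-- The ring endomorphism of `ℤ[ζ]` with `ζ ↦ ζ ^ u`. -/
def conj (u : (ZMod p)ˣ) : CycInt p →ₐ[ℤ] CycInt p :=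
  AdjoinRoot.liftAlgHom (shiftPoly p) (Algebra.ofId ℤ (CycInt p)) (zetaPow p u - 1) (eval_conj p u)

lemma conj_piElt (u : (ZMod p)ˣ) : conj p u (piElt p) = zetaPow p u - 1 := by
  rw [conj, piElt]
  exact AdjoinRoot.liftAlgHom_root ..

lemma conj_zetaPow (u : (ZMod p)ˣ) (a : ZMod p) : conj p u (zetaPow p a) = zetaPow p (u * a) := by
  have h : conj p u (zeta p) = zetaPow p u := by
    rw [zeta, map_add, conj_piElt, map_one, sub_add_cancel]
  rw [zetaPow, map_pow, h, zetaPow_pow, ZMod.natCast_zmod_val]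

lemma conj_one : conj p 1 = AlgHom.id ℤ _ := by
  refine AdjoinRoot.algHom_ext ?_
  change conj p 1 (piElt p) = piElt p
  rw [conj_piElt, Units.val_one, ← Nat.cast_one, zetaPow_natCast]
  simp [zeta]

lemma conj_mul (u v : (ZMod p)ˣ) : conj p (u * v) = (conj p u).comp (conj p v) := by
  refine AdjoinRoot.algHom_ext ?_
  change conj p (u * v) (piElt p) = conj p u (conj p v (piElt p))
  rw [conj_piElt, conj_piElt, map_sub, map_one, conj_zetaPow, Units.val_mul]

/-- The action of the metacyclic group on `ℤ[ζ]`: `x` acts as multiplication by `ζ`, and `y` as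
the Galois automorphism `ζ ↦ ζ ^ m`. -/
def cycRep (m : (ZMod p)ˣ) : Grp p m →* Module.End ℤ (CycInt p) where
  toFun g := LinearMap.mulLeft ℤ (zetaPow p g.left.toAdd) * (conj p (unitHom p m g.right)).toLinearMap
  map_one' := by
    ext a
    simp [zetaPow_zero, conj_one]
  map_mul' g h := by
    ext a
    simp [zetaPow_add, conj_mul, conj_zetaPow, toAdd_powAut, mul_assoc]

/-- The `ℤ`-basis `(ζ - 1) ^ (p - 2), …, ζ - 1, 1` of `ℤ[ζ]`. -/
def cycBasis : Module.Basis (Fin (p - 1)) ℤ (CycInt p) :=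
  ((AdjoinRoot.powerBasis' (shiftPoly_monic p)).basis.reindex
    (finCongr (shiftPoly_natDegree p))).reindex Fin.revPerm

lemma cycBasis_apply (j : Fin (p - 1)) : cycBasis p j = piElt p ^ (j.rev : ℕ) := by
  rw [cycBasis, Module.Basis.reindex_apply, Module.Basis.reindex_apply, PowerBasis.basis_eq_pow,
    AdjoinRoot.powerBasis'_gen]
  rfl

end Cyclotomic

section Rows

variable (p : ℕ)

/-- The ring `𝒯_{p-1}(ℤ, p)` of integral matrices whose entries below the diagonal are divisible
by `p`. -/
def Tri : Subring (Matrix (Fin (p - 1)) (Fin (p - 1)) ℤ) where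
  carrier := {A | ∀ i j, j < i → (p : ℤ) ∣ A i j}
  one_mem' i j h := by simp [h.ne']
  zero_mem' i j _ := by simp
  add_mem' ha hb i j h := dvd_add (ha i j h) (hb i j h)
  neg_mem' ha i j h := (dvd_neg).2 (ha i j h)
  mul_mem' {a b} ha hb i j h := by
    rw [Matrix.mul_apply]
    refine Finset.dvd_sum fun k _ => ?_
    rcases lt_or_ge k i with hk | hk
    · exact Dvd.dvd.mul_right (ha i k hk) _
    · exact Dvd.dvd.mul_left (hb k j (h.trans_le hk)) _

/-- The `i`-th row `R(i)` of `𝒯_{p-1}(ℤ, p)`. -/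
def Row (i : Fin (p - 1)) : AddSubgroup (Fin (p - 1) → ℤ) where
  carrier := {v | ∀ j, j < i → (p : ℤ) ∣ v j}
  zero_mem' j _ := by simp
  add_mem' ha hb j h := dvd_add (ha j h) (hb j h)
  neg_mem' ha j h := (dvd_neg).2 (ha j h)

lemma vecMul_mem_row {i : Fin (p - 1)} {v : Fin (p - 1) → ℤ} (hv : v ∈ Row p i)
    {A : Matrix (Fin (p - 1)) (Fin (p - 1)) ℤ} (hA : A ∈ Tri p) : Matrix.vecMul v A ∈ Row p i := by
  intro j h
  rw [Matrix.vecMul, dotProduct]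
  refine Finset.dvd_sum fun k _ => ?_
  rcases lt_or_ge k i with hk | hk
  · exact Dvd.dvd.mul_right (hv k hk) _
  · exact Dvd.dvd.mul_left (hA k j (h.trans_le hk)) _

/-- Each row is a right `𝒯_{p-1}(ℤ, p)`-module by multiplication of a row vector by a matrix. -/
instance rowTriModule (i : Fin (p - 1)) : Module (Tri p)ᵐᵒᵖ (Row p i) where
  smul A v := ⟨Matrix.vecMul v.1 A.unop.1, vecMul_mem_row p v.2 A.unop.2⟩
  one_smul v := Subtype.ext (Matrix.vecMul_one v.1)
  mul_smul A B v := Subtype.ext (Matrix.vecMul_vecMul v.1 B.unop.1 A.unop.1).symm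
  smul_zero A := Subtype.ext (Matrix.zero_vecMul A.unop.1)
  smul_add A v w := Subtype.ext (Matrix.add_vecMul A.unop.1 v.1 w.1)
  add_smul A B v := Subtype.ext (Matrix.vecMul_add A.unop.1 B.unop.1 v.1)
  zero_smul v := Subtype.ext (Matrix.vecMul_zero v.1)

/-- The `i`-th standard basis vector, which lies in (and generates) `R(i)`. -/
def rowGen (i : Fin (p - 1)) : Row p i :=
  ⟨Pi.single i 1, fun j h => by simp [h.ne]⟩

end Rows

section Lambda

variable (p : ℕ) [Fact p.Prime]

lemma dvd_coeff_shiftPoly {k : ℕ} (hk : k < p - 1) : (p : ℤ) ∣ (shiftPoly p).coeff k := by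
  have h := (cyclotomic_comp_X_add_one_isEisensteinAt p).mem (n := k)
    (by have := shiftPoly_natDegree p; rw [shiftPoly] at this; omega)
  exact Ideal.mem_span_singleton.1 h

/-- `(ζ - 1) ^ (p - 1)` is divisible by `p`. -/
lemma dvd_piElt_pow : ((p : ℤ) : CycInt p) ∣ piElt p ^ (p - 1) := by
  have h : aeval (piElt p) (shiftPoly p) = 0 := by
    rw [piElt, AdjoinRoot.aeval_eq, AdjoinRoot.mk_self]
  rw [aeval_eq_sum_range, shiftPoly_natDegree, Finset.sum_range_succ] at h
  have h1 : (shiftPoly p).coeff (p - 1) = 1 := by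
    have := shiftPoly_monic p
    rwa [Monic, leadingCoeff, shiftPoly_natDegree] at this
  rw [h1, one_smul] at h
  rw [eq_neg_of_add_eq_zero_right h, dvd_neg]
  refine Finset.dvd_sum fun k hk => ?_
  obtain ⟨c, hc⟩ := dvd_coeff_shiftPoly p (Finset.mem_range.1 hk)
  rw [hc, zsmul_eq_mul, Int.cast_mul, mul_assoc]
  exact dvd_mul_right _ _

/-- The coefficients of a multiple of `(ζ - 1) ^ k` at the lower powers of `ζ - 1` are divisible
by `p`. -/
lemma dvd_repr {k : ℕ} {a : CycInt p} (ha : piElt p ^ k ∣ a) (i : Fin (p - 1))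
    (hi : (i.rev : ℕ) < k) : (p : ℤ) ∣ (cycBasis p).repr a i := by
  obtain ⟨b, rfl⟩ := ha
  rw [← (cycBasis p).sum_repr b, Finset.mul_sum, map_sum, Finsupp.finsetSum_apply]
  refine Finset.dvd_sum fun l _ => ?_
  rw [mul_smul_comm, map_smul, Finsupp.smul_apply, smul_eq_mul]
  refine Dvd.dvd.mul_left ?_ _
  rw [cycBasis_apply, ← pow_add]
  rcases lt_or_ge (k + (l.rev : ℕ)) (p - 1) with h | h
  · let t : Fin (p - 1) := Fin.rev ⟨k + (l.rev : ℕ), h⟩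
    have ht : piElt p ^ (k + (l.rev : ℕ)) = cycBasis p t := by
      rw [cycBasis_apply, Fin.rev_rev]
    rw [ht, Module.Basis.repr_self, Finsupp.single_apply, if_neg]
    · exact dvd_zero _
    · rintro rfl
      rw [Fin.rev_rev] at hi
      simp only at hi
      omega
  · obtain ⟨c, hc⟩ := (dvd_piElt_pow p).trans (pow_dvd_pow (piElt p) h)
    rw [hc, ← zsmul_eq_mul, map_smul, Finsupp.smul_apply, smul_eq_mul]
    exact dvd_mul_right _ _

lemma piElt_dvd_zetaPow_sub_one (a : ZMod p) : piElt p ∣ zetaPow p a - 1 := by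
  have h := sub_dvd_pow_sub_pow (zeta p) 1 a.val
  rw [one_pow] at h
  simpa [zeta, zetaPow] using h

/-- The matrix of an element of `Λ` acting on `ℤ[ζ]`, in the basis `cycBasis`. -/
def matRep (m : (ZMod p)ˣ) : GrpRing p m →ₐ[ℤ] Matrix (Fin (p - 1)) (Fin (p - 1)) ℤ :=
  (LinearMap.toMatrixAlgEquiv (cycBasis p)).toAlgHom.comp
    (MonoidAlgebra.lift ℤ (Module.End ℤ (CycInt p)) (Grp p m) (cycRep p m))

lemma matRep_mem (m : (ZMod p)ˣ) (a : GrpRing p m) : (matRep p m).toRingHom a ∈ Tri p := by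
  induction a using MonoidAlgebra.induction_on with
  | of g =>
    intro i j hij
    have h : (matRep p m).toRingHom (MonoidAlgebra.of ℤ (Grp p m) g) i j
        = (cycBasis p).repr (cycRep p m g (cycBasis p j)) i := by
      simp [matRep, LinearMap.toMatrixAlgEquiv_apply]
    rw [h]
    refine dvd_repr p (k := (j.rev : ℕ)) ?_ i (Fin.rev_lt_rev.2 hij)
    have h2 : cycRep p m g (cycBasis p j)
        = zetaPow p g.left.toAdd * (zetaPow p (unitHom p m g.right) - 1) ^ (j.rev : ℕ) := by
      rw [cycBasis_apply, ← conj_piElt, ← map_pow]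
      rfl
    rw [h2]
    exact Dvd.dvd.mul_left (pow_dvd_pow_of_dvd (piElt_dvd_zetaPow_sub_one p _) _) _
  | add a b ha hb => rw [map_add]; exact add_mem ha hb
  | smul r a ha =>
    have h : (matRep p m).toRingHom (r • a) = r • (matRep p m).toRingHom a := map_smul (matRep p m) r a
    rw [h]
    exact zsmul_mem ha r

/-- The ring homomorphism `Λ → 𝒯_{p-1}(ℤ, p)`. -/
def lam (m : (ZMod p)ˣ) : GrpRing p m →+* Tri p :=
  (matRep p m).toRingHom.codRestrict (Tri p) (matRep_mem p m)

/-- `R(i)` as a right `Λ`-module. -/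
instance rowModule (m : (ZMod p)ˣ) (i : Fin (p - 1)) : Module (GrpRing p m)ᵐᵒᵖ (Row p i) :=
  Module.compHom (Row p i) (lam p m).op

/-- The direct sum `R(1) ⊕ ⋯ ⊕ R(p - 1)`. -/
abbrev RowSum := (i : Fin (p - 1)) → Row p i

/-- The direct sum `R(n̂)` of all the `R(i)` with `i ≠ n`. -/
abbrev RowHat (n : Fin (p - 1)) := (i : {i : Fin (p - 1) // i ≠ n}) → Row p i.1

/-- The ring homomorphism `Λ → ℤ[C_{p-1}]` induced by `x ↦ 1`, `y ↦ y`. -/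
def toCyc (m : (ZMod p)ˣ) : GrpRing p m →+* MonoidAlgebra ℤ (CycQ p) :=
  MonoidAlgebra.mapDomainRingHom ℤ (SemidirectProduct.rightHom : Grp p m →* CycQ p)

/-- `ℤ[C_{p-1}]` as a right `Λ`-module. -/
instance cycModule (m : (ZMod p)ˣ) : Module (GrpRing p m)ᵐᵒᵖ (MonoidAlgebra ℤ (CycQ p)) :=
  Module.compHom (MonoidAlgebra ℤ (CycQ p)) (toCyc p m).op

/-- The projection `Λ → ℤ[C_{p-1}]` as a homomorphism of right `Λ`-modules. -/
def toCycLin (m : (ZMod p)ˣ) : GrpRing p m →ₗ[(GrpRing p m)ᵐᵒᵖ] MonoidAlgebra ℤ (CycQ p) where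
  toFun := toCyc p m
  map_add' := map_add _
  map_smul' a b := map_mul (toCyc p m) b a.unop

end Lambda

section Extensions

variable {A M L N Q K : Type*} [Ring A] [AddCommGroup M] [Module A M] [AddCommGroup L] [Module A L]
  [AddCommGroup N] [Module A N] [AddCommGroup Q] [Module A Q] [AddCommGroup K] [Module A K]

/-- `(M --j--> L --ε--> Q)` is a short exact sequence `0 → M → L → Q → 0`. -/
def IsShortExact (j : M →ₗ[A] L) (ε : L →ₗ[A] Q) : Prop :=
  Function.Injective j ∧ Function.Exact j ε ∧ Function.Surjective ε

/-- The pushout of `N <--f-- M --j--> L`, i.e. `(N ⊕ L) / {(f t, -j t)}`. -/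
abbrev Pushout (j : M →ₗ[A] L) (f : M →ₗ[A] N) :=
  (N × L) ⧸ LinearMap.range (f.prod (-j))

/-- The extension `0 → N --ι--> K --q--> Q → 0` is congruent to the pushout along `f : M → N` of the
extension `0 → M --j--> L --ε--> Q → 0`. -/
def IsPushoutExt (j : M →ₗ[A] L) (ε : L →ₗ[A] Q) (f : M →ₗ[A] N) (ι : N →ₗ[A] K)
    (q : K →ₗ[A] Q) : Prop :=
  ∃ e : Pushout j f ≃ₗ[A] K,
    (∀ a : N, e (Submodule.Quotient.mk (a, 0)) = ι a) ∧
      ∀ (a : N) (l : L), q (e (Submodule.Quotient.mk (a, l))) = ε l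

end Extensions

section KInvariants

variable {p : ℕ} [Fact p.Prime] {m : (ZMod p)ˣ} {n : Fin (p - 1)}

/-- The `i`-th `k`-invariant of `f : R(1) ⊕ ⋯ ⊕ R(p - 1) → R(n̂)`, `i ≠ n`. The component
`R(i) → R(i)` of `f` is multiplication by an integer, which is read off as the `i`-th coordinate of
the image of the `i`-th standard basis vector; the `k`-invariant is this integer mod `p`. -/
def kInvariant (f : RowSum p →ₗ[(GrpRing p m)ᵐᵒᵖ] RowHat p n) (i : {i : Fin (p - 1) // i ≠ n}) :
    ZMod p :=
  (((f (Pi.single i.1 (rowGen p i.1)) i).1 i.1 : ℤ) : ZMod p)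

/-- All `k`-invariants of the extension `0 → R(n̂) --ι--> K --q--> ℤ[C_{p-1}] → 0` are nonzero: it is
the pushout, along some `f` with nonzero `k`-invariants, of an extension
`0 → R(1) ⊕ ⋯ ⊕ R(p - 1) → Λ → ℤ[C_{p-1}] → 0` whose second map is the projection. -/
def HasNonzeroKInvariants {K : Type*} [AddCommGroup K] [Module (GrpRing p m)ᵐᵒᵖ K]
    (ι : RowHat p n →ₗ[(GrpRing p m)ᵐᵒᵖ] K)
    (q : K →ₗ[(GrpRing p m)ᵐᵒᵖ] MonoidAlgebra ℤ (CycQ p)) : Prop :=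
  ∃ (j : RowSum p →ₗ[(GrpRing p m)ᵐᵒᵖ] GrpRing p m)
    (f : RowSum p →ₗ[(GrpRing p m)ᵐᵒᵖ] RowHat p n),
    IsShortExact j (toCycLin p m) ∧ IsPushoutExt j (toCycLin p m) f ι q ∧
      ∀ i, kInvariant f i ≠ 0

end KInvariants

end Metacyclic

end

/-! `K` is the pushout of `Ψ` along `f`, and changing `f` by a map that extends to `Λ` does not
change the pushout up to isomorphism. So it suffices to replace `f` by a surjection whose kernel is
a copy of `R(n)`: the pushout is then `Λ` modulo that kernel (`nonempty_pushout_equiv`).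

The kernel of `ε` is `(x - 1)Λ`, so a map into `R(n̂)` extends once the image of `x - 1` lies in
`R(n̂)(x - 1)`. As `R(i)(x - 1)` is cut out of `R(i)` by divisibility of the `i`-th coordinate by
`p`, only these coordinates mod `p` matter (`exists_extension`). There `y` acts by distinct powers
of `m`, so maps between different rows vanish, and `f` is seen only through its `k`-invariants
(`dvd_apply_sub_kInvariant`).

It remains to realise the `k`-invariants by an automorphism of `⨁ R(i)` followed by the projection
to `R(n̂)`. They are units mod `p` and the `n`-th diagonal entry is free, so they lift to an
invertible integral matrix that is diagonal mod `p` (`exists_matrix_lift`), which acts on the sum of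
the rows. -/

noncomputable section

namespace Metacyclic

open Polynomial

/-! ### Pushouts along maps that agree up to an extendable map. -/

section Pushouts

variable {A M L N : Type*} [Ring A] [AddCommGroup M] [Module A M] [AddCommGroup L] [Module A L]
  [AddCommGroup N] [Module A N]

/-- If `f` differs from a surjection `f'` by a map which extends along `j`, then the pushout of `j`
along `f` is the quotient of `L` by the image of the kernel of `f'`. -/
lemma nonempty_pushout_equiv {j : M →ₗ[A] L} {f f' : M →ₗ[A] N} {g : L →ₗ[A] N}
    (hf : ∀ t, f t = f' t + g (j t)) (hs : Function.Surjective f') :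
    Nonempty (Pushout j f ≃ₗ[A] L ⧸ (LinearMap.ker f').map j) := by
  -- The twist by `-g` compensates for replacing `f` by `f'`.
  let φ : L →ₗ[A] Pushout j f :=
    (LinearMap.range (f.prod (-j))).mkQ ∘ₗ ((-g).prod LinearMap.id)
  have hφ : ∀ l, φ l = Submodule.Quotient.mk (-g l, l) := fun l => rfl
  have hsurj : Function.Surjective φ := by
    intro z
    obtain ⟨⟨a, l⟩, rfl⟩ := Submodule.Quotient.mk_surjective _ z
    obtain ⟨t, ht⟩ := hs (a + g l)
    refine ⟨l + j t, ?_⟩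
    rw [hφ, Submodule.Quotient.eq]
    refine ⟨-t, ?_⟩
    ext
    · simp [hf, ht]; abel
    · simp
  have hker : LinearMap.ker φ = (LinearMap.ker f').map j := by
    ext l
    rw [LinearMap.mem_ker, hφ, Submodule.Quotient.mk_eq_zero, Submodule.mem_map]
    constructor
    · rintro ⟨t, ht⟩
      have h1 : f t = -g l := congrArg Prod.fst ht
      have h2 : -j t = l := congrArg Prod.snd ht
      refine ⟨-t, ?_, by simpa using h2⟩
      rw [hf, ← h2, map_neg, neg_neg] at h1
      simpa using h1
    · rintro ⟨t, ht, rfl⟩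
      refine ⟨-t, ?_⟩
      rw [LinearMap.mem_ker] at ht
      ext
      · simp [hf, ht]
      · simp
  exact ⟨((Submodule.quotEquivOfEq _ _ hker.symm).trans
    (φ.quotKerEquivOfSurjective hsurj)).symm⟩

end Pushouts

/-! ### Lifting diagonal matrices mod `p` to invertible integral matrices. -/

section Matrices

variable {ι : Type*} [Fintype ι] [DecidableEq ι]

/-- For `u u' ≡ 1 mod p²` the matrix `diag (u, u')` in the rows and columns `i, n` is congruent
mod `p` to an invertible one. -/
lemma exists_block {p u u' k : ℤ} (h : u * u' = 1 + p ^ 2 * k) {i n : ι} (hi : i ≠ n) :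
    ∃ A B : Matrix ι ι ℤ, A * B = 1 ∧ B * A = 1 ∧ (∀ a b, a ≠ b → p ∣ A a b) ∧
      A i i = u ∧ ∀ a, a ≠ i → a ≠ n → A a a = 1 := by
  let E : ι → ι → ℤ → Matrix ι ι ℤ := Matrix.single
  -- In the rows and columns `i, n` these are the block `(u, x; y, u')`, of determinant `u u' - x y
  -- = 1`, and its adjugate. The symmetry in `u, u'` also gives the product in the other order.
  have key : ∀ u u' : ℤ, u * u' = 1 + p ^ 2 * k → ∀ x y : ℤ, x * y = p ^ 2 * k →
      (1 + E i i (u - 1) + E i n x + E n i y + E n n (u' - 1)) *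
        (1 + E i i (u' - 1) + E i n (-x) + E n i (-y) + E n n (u - 1)) = 1 := by
    intro u u' h x y hxy
    ext a b
    by_cases ha : a = i
    · subst ha
      by_cases hb : b = a
      · subst hb
        simp [E, mul_add, add_mul, hi, hi.symm]
        linarith
      · by_cases hb' : b = n
        · subst hb'
          simp [E, mul_add, add_mul, hi, hi.symm]
          linarith
        · simp [E, mul_add, add_mul, hi, hi.symm, Ne.symm hb, Ne.symm hb']
    · by_cases ha' : a = n
      · subst ha'
        by_cases hb : b = i
        · subst hb
          simp [E, mul_add, add_mul, hi, hi.symm]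
          linarith
        · by_cases hb' : b = a
          · subst hb'
            simp [E, mul_add, add_mul, hi, hi.symm]
            linarith
          · simp [E, mul_add, add_mul, hi, hi.symm, Ne.symm hb, Ne.symm hb']
      · simp [E, mul_add, add_mul, hi, hi.symm, Ne.symm ha, Ne.symm ha']
  refine ⟨1 + E i i (u - 1) + E i n p + E n i (p * k) + E n n (u' - 1),
    1 + E i i (u' - 1) + E i n (-p) + E n i (-(p * k)) + E n n (u - 1),
    key u u' h _ _ (by ring), ?_, ?_, ?_, ?_⟩
  · have := key u' u (by linarith) (-p) (-(p * k)) (by ring)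
    simpa using this
  · intro a b hab
    simp only [E, Matrix.add_apply, Matrix.one_apply_ne hab, Matrix.single_apply]
    refine dvd_add (dvd_add (dvd_add (dvd_add (dvd_zero _) ?_) ?_) ?_) ?_
    · rw [if_neg]
      · exact dvd_zero _
      · rintro ⟨rfl, rfl⟩; exact hab rfl
    · split_ifs <;> simp
    · split_ifs <;> simp
    · rw [if_neg]
      · exact dvd_zero _
      · rintro ⟨rfl, rfl⟩; exact hab rfl
  · simp [E, hi.symm]
  · intro a h1 h2
    simp [E, Ne.symm h1, Ne.symm h2]

/-- A diagonal matrix mod `p` with all but one of its entries prescribed units lifts to an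
invertible integral matrix. -/
lemma exists_matrix_lift {p : ℕ} [Fact p.Prime] (n : ι) (d : ι → ℤ)
    (hd : ∀ i, i ≠ n → ¬ (p : ℤ) ∣ d i) :
    ∃ A B : Matrix ι ι ℤ, A * B = 1 ∧ B * A = 1 ∧ (∀ a b, a ≠ b → (p : ℤ) ∣ A a b) ∧
      ∀ i, i ≠ n → (p : ℤ) ∣ A i i - d i := by
  -- Diagonal entries multiply mod `p`, so they are corrected one at a time; the `n`-th entry
  -- absorbs the inverses.
  suffices H : ∀ s : Finset ι, n ∉ s →
      ∃ A B : Matrix ι ι ℤ, A * B = 1 ∧ B * A = 1 ∧ (∀ a b, a ≠ b → (p : ℤ) ∣ A a b) ∧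
        (∀ i ∈ s, (p : ℤ) ∣ A i i - d i) ∧ ∀ i, i ∉ s → i ≠ n → (p : ℤ) ∣ A i i - 1 by
    obtain ⟨A, B, h1, h2, h3, h4, -⟩ := H (Finset.univ.erase n) (by simp)
    exact ⟨A, B, h1, h2, h3, fun i hi => h4 i (by simp [hi])⟩
  intro s
  induction s using Finset.induction_on with
  | empty =>
    exact fun _ => ⟨1, 1, by simp, by simp, fun a b h => by simp [h], by simp, by simp⟩
  | insert i s his ih =>
    intro hn
    have hin : i ≠ n := fun h => hn (by simp [h])
    obtain ⟨A, B, h1, h2, h3, h4, h5⟩ := ih fun h => hn (Finset.mem_insert_of_mem h)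
    have hcop : IsCoprime (d i) ((p : ℤ) ^ 2) :=
      (((Nat.prime_iff_prime_int.1 (Fact.out : p.Prime)).coprime_iff_not_dvd.2
        (hd i hin)).symm).pow_right
    obtain ⟨u', k, hk⟩ := hcop
    obtain ⟨A', B', h1', h2', h3', h4', h5'⟩ :=
      exists_block (p := p) (u := d i) (u' := u') (k := -k) (by linarith) hin
    have hdiag : ∀ a, (p : ℤ) ∣ (A * A') a a - A a a * A' a a := by
      intro a
      rw [Matrix.mul_apply, ← Finset.add_sum_erase _ _ (Finset.mem_univ a), add_sub_cancel_left]
      exact Finset.dvd_sum fun l hl => Dvd.dvd.mul_right (h3 a l (Finset.ne_of_mem_erase hl).symm) _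
    refine ⟨A * A', B' * B, ?_, ?_, ?_, ?_, ?_⟩
    · rw [mul_assoc, ← mul_assoc A', h1', one_mul, h1]
    · rw [mul_assoc, ← mul_assoc B, h2, one_mul, h2']
    · intro a b hab
      rw [Matrix.mul_apply]
      refine Finset.dvd_sum fun l _ => ?_
      by_cases hl : a = l
      · subst hl
        exact Dvd.dvd.mul_left (h3' _ _ hab) _
      · exact Dvd.dvd.mul_right (h3 _ _ hl) _
    · intro a ha
      rcases Finset.mem_insert.1 ha with rfl | ha
      · have := dvd_add (hdiag a) ((h5 a his hin).mul_right (A' a a))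
        rw [h4'] at this
        obtain ⟨z, hz⟩ := this
        exact ⟨z, by linear_combination hz⟩
      · have han : a ≠ n := fun h => hn (Finset.mem_insert_of_mem (h ▸ ha))
        have hai : a ≠ i := fun h => his (h ▸ ha)
        have := dvd_add (hdiag a) (h4 a ha)
        rw [h5' a hai han] at this
        obtain ⟨z, hz⟩ := this
        exact ⟨z, by linear_combination hz⟩
    · intro a ha han
      rw [Finset.mem_insert, not_or] at ha
      have := dvd_add (hdiag a) (h5 a ha.2 han)
      rw [h5' a ha.1 han] at this
      obtain ⟨z, hz⟩ := this
      exact ⟨z, by linear_combination hz⟩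

/-- Mod `p`, the `(a, a)` and `(a, b)` entries of `A * B = 1` say that `A a a` is a unit and that `A
a a * B a b` vanishes. -/
lemma dvd_of_mul_eq_one {p : ℤ} {A B : Matrix ι ι ℤ} (h : A * B = 1)
    (hA : ∀ a b, a ≠ b → p ∣ A a b) {a b : ι} (hab : a ≠ b) : p ∣ B a b := by
  have key : ∀ b, p ∣ (A * B) a b - A a a * B a b := by
    intro b
    rw [Matrix.mul_apply, ← Finset.add_sum_erase _ _ (Finset.mem_univ a), add_sub_cancel_left]
    exact Finset.dvd_sum fun l hl => Dvd.dvd.mul_right (hA a l (Finset.ne_of_mem_erase hl).symm) _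
  obtain ⟨x, hx⟩ := key a
  obtain ⟨y, hy⟩ := key b
  rw [h, Matrix.one_apply_eq] at hx
  rw [h, Matrix.one_apply_ne hab] at hy
  exact ⟨x * B a b - B a a * y, by linear_combination B a b * hx - B a a * hy⟩

end Matrices

/-! ### The action of `x - 1` and `y` on the rows. -/

section Generators

variable (p : ℕ) [Fact p.Prime] (m : (ZMod p)ˣ)

/-- The generator `x`, as an element of `Λ`. -/
def genX : GrpRing p m :=
  MonoidAlgebra.of ℤ (Grp p m) (SemidirectProduct.inl (Multiplicative.ofAdd 1))

/-- The generator `y`, as an element of `Λ`. -/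
def genY : GrpRing p m :=
  MonoidAlgebra.of ℤ (Grp p m) (SemidirectProduct.inr (Multiplicative.ofAdd 1))

lemma matRep_of_apply (g : Grp p m) (i j : Fin (p - 1)) :
    (matRep p m).toRingHom (MonoidAlgebra.of ℤ (Grp p m) g) i j
      = (cycBasis p).repr (cycRep p m g (cycBasis p j)) i := by
  simp [matRep, LinearMap.toMatrixAlgEquiv_apply]

lemma lam_genX_sub_one_apply (i j : Fin (p - 1)) :
    (lam p m (genX p m - 1)).1 i j = (cycBasis p).repr (piElt p * cycBasis p j) i := by
  have h1 : (1 : GrpRing p m) = MonoidAlgebra.of ℤ (Grp p m) 1 := rfl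
  change (matRep p m).toRingHom (genX p m - 1) i j = _
  rw [map_sub, Matrix.sub_apply, genX, matRep_of_apply, h1, matRep_of_apply, ← Finsupp.sub_apply,
    ← map_sub]
  congr 2
  have h2 : zetaPow p 1 = zeta p := by simpa using zetaPow_natCast p 1
  simp [cycRep, h2, conj_one, zetaPow_zero, zeta, add_mul]

/-- The basis runs through decreasing powers of `ζ - 1`, so multiplication by `ζ - 1` lowers the
index by one, except at index `0`, where the minimal polynomial enters. -/
lemma repr_piElt_mul_of_pos (i j : Fin (p - 1)) (hj : 0 < (j : ℕ)) :
    (cycBasis p).repr (piElt p * cycBasis p j) i = if (i : ℕ) + 1 = j then 1 else 0 := by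
  have h : piElt p * cycBasis p j = cycBasis p ⟨j - 1, by omega⟩ := by
    rw [cycBasis_apply, cycBasis_apply, ← pow_succ']
    congr 1
    simp only [Fin.val_rev]
    omega
  rw [h, Module.Basis.repr_self, Finsupp.single_apply]
  congr 1
  rw [Fin.ext_iff, eq_iff_iff]
  simp only
  omega

lemma repr_piElt_mul_of_eq_zero (i j : Fin (p - 1)) (hj : (j : ℕ) = 0) :
    (cycBasis p).repr (piElt p * cycBasis p j) i = -(shiftPoly p).coeff (i.rev : ℕ) := by
  have h : aeval (piElt p) (shiftPoly p) = 0 := by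
    rw [piElt, AdjoinRoot.aeval_eq, AdjoinRoot.mk_self]
  rw [aeval_eq_sum_range, shiftPoly_natDegree, Finset.sum_range_succ] at h
  have h1 : (shiftPoly p).coeff (p - 1) = 1 := by
    have := shiftPoly_monic p
    rwa [Monic, leadingCoeff, shiftPoly_natDegree] at this
  rw [h1, one_smul] at h
  have h2 : piElt p * cycBasis p j = piElt p ^ (p - 1) := by
    rw [cycBasis_apply, ← pow_succ']
    congr 1
    simp only [Fin.val_rev]
    omega
  have h3 : ∑ k ∈ Finset.range (p - 1), (shiftPoly p).coeff k • piElt p ^ k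
      = ∑ l, (shiftPoly p).coeff (l.rev : ℕ) • cycBasis p l := by
    rw [Finset.sum_range]
    refine Fintype.sum_equiv Fin.revPerm _ _ fun l => ?_
    rw [cycBasis_apply, Fin.revPerm_apply, Fin.rev_rev]
  rw [h2, eq_neg_of_add_eq_zero_right h, h3, map_neg, Finsupp.neg_apply, Module.Basis.repr_sum_self]

lemma coeff_zero_shiftPoly : (shiftPoly p).coeff 0 = p := by
  rw [coeff_zero_eq_eval_zero, shiftPoly, eval_comp]
  simp [cyclotomic_prime]

variable {p m}

lemma smul_row_val (a : GrpRing p m) {i : Fin (p - 1)} (v : Row p i) :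
    (MulOpposite.op a • v).1 = Matrix.vecMul v.1 (lam p m a).1 := rfl

lemma smul_genX_sub_one_of_pos {i : Fin (p - 1)} (v : Row p i) (k : Fin (p - 1))
    (hk : 0 < (k : ℕ)) :
    (MulOpposite.op (genX p m - 1) • v).1 k = v.1 ⟨k - 1, by omega⟩ := by
  rw [smul_row_val, Matrix.vecMul, dotProduct, Finset.sum_eq_single ⟨k - 1, by omega⟩]
  · rw [lam_genX_sub_one_apply, repr_piElt_mul_of_pos p _ _ hk, if_pos, mul_one]
    simp only
    omega
  · intro l _ hl
    rw [lam_genX_sub_one_apply, repr_piElt_mul_of_pos p _ _ hk, if_neg, mul_zero]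
    rw [ne_eq, Fin.ext_iff] at hl
    simp only at hl
    omega
  · simp

lemma smul_genX_sub_one_of_eq_zero {i : Fin (p - 1)} (v : Row p i) (k : Fin (p - 1))
    (hk : (k : ℕ) = 0) :
    (MulOpposite.op (genX p m - 1) • v).1 k
      = -∑ l, v.1 l * (shiftPoly p).coeff (l.rev : ℕ) := by
  rw [smul_row_val, Matrix.vecMul, dotProduct, ← Finset.sum_neg_distrib]
  refine Finset.sum_congr rfl fun l _ => ?_
  rw [lam_genX_sub_one_apply, repr_piElt_mul_of_eq_zero p _ _ hk, mul_neg]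

/-- The new `i`-th coordinate is the old one at `i - 1`, divisible by `p` in `R(i)`; for `i = 0` it
is a combination of the Eisenstein coefficients. -/
lemma dvd_smul_genX_sub_one {i : Fin (p - 1)} (v : Row p i) :
    (p : ℤ) ∣ (MulOpposite.op (genX p m - 1) • v).1 i := by
  rcases Nat.eq_zero_or_pos (i : ℕ) with h | h
  · rw [smul_genX_sub_one_of_eq_zero v i h, dvd_neg]
    exact Finset.dvd_sum fun l _ => Dvd.dvd.mul_left (dvd_coeff_shiftPoly p l.rev.2) _
  · rw [smul_genX_sub_one_of_pos v i h]
    refine v.2 _ (Fin.lt_def.2 ?_)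
    simp only
    omega

/-- The elements of `R(i) (x - 1)` are those whose `i`-th coordinate is divisible by `p`. -/
lemma exists_smul_genX_sub_one {i : Fin (p - 1)} (w : Row p i) (hw : (p : ℤ) ∣ w.1 i) :
    ∃ v : Row p i, MulOpposite.op (genX p m - 1) • v = w := by
  have hp0 : 0 < p - 1 := i.pos
  let last : Fin (p - 1) := ⟨p - 2, by omega⟩
  have hw' : ∀ k, k ≤ i → (p : ℤ) ∣ w.1 k := fun k hk => by
    rcases hk.eq_or_lt with rfl | hk
    · exact hw
    · exact w.2 k hk
  -- Coordinates of `w` at positive indices force all of `v` but its last entry. That entry meets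
  -- the constant coefficient `p`, so it can be chosen to match `w` at index `0`.
  let z : Fin (p - 1) → ℤ := fun l => if h : (l : ℕ) + 1 < p - 1 then w.1 ⟨l + 1, h⟩ else 0
  obtain ⟨c, hc⟩ : (p : ℤ) ∣ w.1 ⟨0, hp0⟩ + ∑ l, z l * (shiftPoly p).coeff (l.rev : ℕ) :=
    dvd_add (hw' _ (Fin.le_def.2 (Nat.zero_le _)))
      (Finset.dvd_sum fun l _ => Dvd.dvd.mul_left (dvd_coeff_shiftPoly p l.rev.2) _)
  let v : Fin (p - 1) → ℤ := z + Pi.single last (-c)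
  have hvz : ∀ l : Fin (p - 1), (l : ℕ) + 1 < p - 1 → v l = z l := fun l hl => by
    have : l ≠ last := fun h => by rw [h] at hl; simp only [last] at hl; omega
    simp [v, this]
  have hv : v ∈ Row p i := by
    intro l hl
    have hl' : (l : ℕ) + 1 < p - 1 := by have := i.2; have := Fin.lt_def.1 hl; omega
    rw [hvz l hl']
    simp only [z, dif_pos hl']
    exact hw' _ (Fin.le_def.2 (Fin.lt_def.1 hl))
  refine ⟨⟨v, hv⟩, Subtype.ext (funext fun k => ?_)⟩
  rcases Nat.eq_zero_or_pos (k : ℕ) with h | h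
  · rw [smul_genX_sub_one_of_eq_zero _ k h]
    have hk : k = ⟨0, hp0⟩ := Fin.ext h
    have hlast : (last.rev : ℕ) = 0 := by simp only [Fin.val_rev, last]; omega
    have hsum : ∑ l, v l * (shiftPoly p).coeff (l.rev : ℕ)
        = ∑ l, z l * (shiftPoly p).coeff (l.rev : ℕ) + -c * p := by
      simp only [v, Pi.add_apply, add_mul, Finset.sum_add_distrib]
      congr 1
      rw [Finset.sum_eq_single last]
      · rw [Pi.single_eq_same, hlast, coeff_zero_shiftPoly]
      · intro l _ hl; simp [hl]
      · simp
    simp only [hsum, hk]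
    linarith
  · rw [smul_genX_sub_one_of_pos _ k h]
    have h1 : (k : ℕ) - 1 + 1 < p - 1 := by omega
    change v _ = _
    rw [hvz _ h1]
    simp only [z, dif_pos h1]
    exact congrArg w.1 (Fin.ext (Nat.sub_add_cancel h))

/-- On `R(i) / R(i) (x - 1)` the generator `y` acts as a power of `m`. -/
lemma dvd_smul_genY (hp : p ≠ 2) {i : Fin (p - 1)} (v : Row p i) :
    (p : ℤ) ∣ (MulOpposite.op (genY p m) • v).1 i
      - ((m : ZMod p).val : ℤ) ^ (i.rev : ℕ) * v.1 i := by
  set r : ℕ := (i.rev : ℕ) with hr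
  set t : ℕ := (m : ZMod p).val with ht
  have hu : unitHom p m (Multiplicative.ofAdd 1) = m := by
    have : Fact (1 < p - 1) := ⟨by have := (Fact.out : p.Prime).two_le; omega⟩
    change m ^ (1 : ZMod (p - 1)).val = m
    rw [ZMod.val_one, pow_one]
  have hdiag : (p : ℤ) ∣ (lam p m (genY p m)).1 i i - (t : ℤ) ^ r := by
    have h1 : (lam p m (genY p m)).1 i i
        = (cycBasis p).repr ((zetaPow p m - 1) ^ r) i := by
      change (matRep p m).toRingHom (genY p m) i i = _
      rw [genY, matRep_of_apply, cycBasis_apply, ← conj_piElt, ← map_pow]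
      simp [cycRep, hu, zetaPow_zero, hr]
    -- `ζ ^ m - 1` is `ζ - 1` times a sum of `t` powers of `ζ`, each congruent to `1` mod `ζ - 1`.
    have h2 : piElt p ^ (r + 1) ∣ (zetaPow p m - 1) ^ r - (t : ℤ) ^ r • cycBasis p i := by
      have h3 : zetaPow p m - 1 = piElt p * ∑ k ∈ Finset.range t, zeta p ^ k := by
        have := geom_sum_mul (zeta p) t
        rw [zetaPow, ← ht, ← this, mul_comm]
        simp [zeta]
      have h4 : piElt p ∣ (∑ k ∈ Finset.range t, zeta p ^ k) - (t : CycInt p) := by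
        have : (∑ k ∈ Finset.range t, zeta p ^ k) - (t : CycInt p)
            = ∑ k ∈ Finset.range t, (zeta p ^ k - 1) := by simp
        rw [this]
        refine Finset.dvd_sum fun k _ => ?_
        rw [← zetaPow_natCast]
        exact piElt_dvd_zetaPow_sub_one p _
      have h5 : (zetaPow p m - 1) ^ r - (t : ℤ) ^ r • cycBasis p i
          = piElt p ^ r * ((∑ k ∈ Finset.range t, zeta p ^ k) ^ r - (t : CycInt p) ^ r) := by
        rw [h3, cycBasis_apply, mul_pow, zsmul_eq_mul]
        push_cast
        ring
      rw [h5, pow_succ]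
      exact mul_dvd_mul_left _ (h4.trans (sub_dvd_pow_sub_pow _ _ _))
    have h6 := dvd_repr p h2 i (Nat.lt_succ_self _)
    rw [map_sub, map_smul, Module.Basis.repr_self, Finsupp.sub_apply, Finsupp.smul_apply,
      Finsupp.single_eq_same, smul_eq_mul, mul_one] at h6
    rwa [h1]
  rw [smul_row_val, Matrix.vecMul, dotProduct, ← Finset.add_sum_erase _ _ (Finset.mem_univ i)]
  have h7 : (p : ℤ) ∣ ∑ l ∈ Finset.univ.erase i, v.1 l * (lam p m (genY p m)).1 l i := by
    refine Finset.dvd_sum fun l hl => ?_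
    rcases lt_or_gt_of_ne (Finset.ne_of_mem_erase hl) with h | h
    · exact Dvd.dvd.mul_right (v.2 l h) _
    · exact Dvd.dvd.mul_left ((lam p m (genY p m)).2 l i h) _
  have := dvd_add (hdiag.mul_left (v.1 i)) h7
  obtain ⟨z, hz⟩ := this
  exact ⟨z, by linear_combination hz⟩

/-! ### Homomorphisms between rows, mod `p`. -/

variable {i j : Fin (p - 1)} (h : Row p j →ₗ[(GrpRing p m)ᵐᵒᵖ] Row p i)

/-- Such a `v` is a multiple of `x - 1`, hence so is its image. -/
lemma dvd_hom_apply_of_dvd {v : Row p j} (hv : (p : ℤ) ∣ v.1 j) : (p : ℤ) ∣ (h v).1 i := by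
  obtain ⟨w, rfl⟩ := exists_smul_genX_sub_one (m := m) v hv
  rw [map_smul]
  exact dvd_smul_genX_sub_one _

lemma dvd_hom_apply_sub (v : Row p j) :
    (p : ℤ) ∣ (h v).1 i - v.1 j * (h (rowGen p j)).1 i := by
  have := dvd_hom_apply_of_dvd h (v := v - v.1 j • rowGen p j) (by simp [rowGen])
  rw [map_sub, map_zsmul] at this
  simpa using this

/-- `h` induces a `y`-equivariant map between copies of `ℤ/p` on which `y` acts by different powers
of `m`, as `m` has order `p - 1`. -/
lemma dvd_hom_apply_of_ne (hp : p ≠ 2) (hm : orderOf m = p - 1) (hij : i ≠ j) (v : Row p j) :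
    (p : ℤ) ∣ (h v).1 i := by
  suffices H : (p : ℤ) ∣ (h (rowGen p j)).1 i by
    have := dvd_add (dvd_hom_apply_sub h v) (H.mul_left (v.1 j))
    simpa using this
  set t : ℕ := (m : ZMod p).val with ht
  have h1 := dvd_hom_apply_sub h (MulOpposite.op (genY p m) • rowGen p j)
  rw [map_smul] at h1
  have h2 := dvd_smul_genY (m := m) hp (h (rowGen p j))
  have h3 := (dvd_smul_genY (m := m) hp (rowGen p j)).mul_right ((h (rowGen p j)).1 i)
  have hgen : (rowGen p j).1 j = 1 := by simp [rowGen]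
  rw [hgen, mul_one] at h3
  have h4 : (p : ℤ) ∣ ((t : ℤ) ^ (i.rev : ℕ) - (t : ℤ) ^ (j.rev : ℕ)) * (h (rowGen p j)).1 i := by
    have := dvd_sub (dvd_add h1 h3) h2
    obtain ⟨z, hz⟩ := this
    exact ⟨z, by linear_combination hz⟩
  refine ((Nat.prime_iff_prime_int.1 (Fact.out : p.Prime)).dvd_or_dvd h4).resolve_left fun h5 => ?_
  have h6 : m ^ (i.rev : ℕ) = m ^ (j.rev : ℕ) := by
    rw [← ZMod.intCast_zmod_eq_zero_iff_dvd] at h5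
    push_cast at h5
    rw [ht, ZMod.natCast_zmod_val, sub_eq_zero] at h5
    exact Units.ext (by simpa using h5)
  rw [pow_inj_mod, hm, Nat.mod_eq_of_lt i.rev.2, Nat.mod_eq_of_lt j.rev.2] at h6
  exact hij (Fin.rev_injective (Fin.ext h6))

end Generators

/-! ### Extending homomorphisms from `(x - 1)Λ` to `Λ`. -/

section Kernel

variable {p : ℕ} [Fact p.Prime] {m : (ZMod p)ˣ}

lemma toCyc_genX_sub_one : toCyc p m (genX p m - 1) = 0 := by
  rw [map_sub, map_one, sub_eq_zero, genX, toCyc, MonoidAlgebra.of_apply,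
    MonoidAlgebra.mapDomainRingHom_apply, MonoidAlgebra.mapDomain_single]
  simp [MonoidAlgebra.one_def]

/-- The kernel of `Λ → ℤ[C_{p-1}]` is generated by `x - 1` as a right ideal. -/
lemma exists_genX_sub_one_mul {a : GrpRing p m} (ha : toCyc p m a = 0) :
    ∃ b, (genX p m - 1) * b = a := by
  -- A ring section of `ε`: it suffices to divide `a - s (ε a)` by `x - 1`, which on group elements
  -- is a geometric sum.
  let s : MonoidAlgebra ℤ (CycQ p) →+* GrpRing p m :=
    MonoidAlgebra.mapDomainRingHom ℤ (SemidirectProduct.inr : CycQ p →* Grp p m)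
  suffices H : ∀ a : GrpRing p m, genX p m - 1 ∣ a - s (toCyc p m a) by
    obtain ⟨b, hb⟩ := H a
    exact ⟨b, by rw [← hb, ha, map_zero, sub_zero]⟩
  intro a
  induction a using MonoidAlgebra.induction_on with
  | of g =>
    have h1 : s (toCyc p m (MonoidAlgebra.of ℤ (Grp p m) g))
        = MonoidAlgebra.of ℤ (Grp p m) (SemidirectProduct.inr g.right) := by
      simp [s, toCyc]
    have h2 : MonoidAlgebra.of ℤ (Grp p m) g = genX p m ^ g.left.toAdd.val
        * MonoidAlgebra.of ℤ (Grp p m) (SemidirectProduct.inr g.right) := by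
      rw [genX, ← map_pow, ← map_mul, ← map_pow, ← ofAdd_nsmul, nsmul_one, ZMod.natCast_zmod_val,
        ofAdd_toAdd, SemidirectProduct.inl_left_mul_inr_right]
    refine ⟨(∑ k ∈ Finset.range g.left.toAdd.val, genX p m ^ k)
      * MonoidAlgebra.of ℤ (Grp p m) (SemidirectProduct.inr g.right), ?_⟩
    rw [h1, ← mul_assoc, mul_geom_sum, sub_mul, one_mul, ← h2]
  | add a b ha hb =>
    rw [map_add, map_add, add_sub_add_comm]
    exact dvd_add ha hb
  | smul r a ha =>
    obtain ⟨c, hc⟩ := ha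
    refine ⟨r • c, ?_⟩
    rw [mul_smul_comm, ← hc, map_zsmul, map_zsmul, smul_sub]

/-- A homomorphism to `R(n̂)` extends from the kernel of `Λ → ℤ[C_{p-1}]` to `Λ` if the `i`-th
coordinate of its `i`-th component is always divisible by `p`. -/
lemma exists_extension {n : Fin (p - 1)} {j : RowSum p →ₗ[(GrpRing p m)ᵐᵒᵖ] GrpRing p m}
    (hj : IsShortExact j (toCycLin p m)) (d : RowSum p →ₗ[(GrpRing p m)ᵐᵒᵖ] RowHat p n)
    (hd : ∀ t i, (p : ℤ) ∣ (d t i).1 i.1) :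
    ∃ g : GrpRing p m →ₗ[(GrpRing p m)ᵐᵒᵖ] RowHat p n, ∀ t, d t = g (j t) := by
  -- `t₀` generates `⨁ R(i)`, so `1 ↦ r'` extends `d` as soon as `r' (x - 1) = d t₀`.
  obtain ⟨t₀, ht₀⟩ := (hj.2.1 (genX p m - 1)).1 toCyc_genX_sub_one
  choose r hr using fun i => exists_smul_genX_sub_one (m := m) (d t₀ i) (hd t₀ i)
  let r' : RowHat p n := r
  let g : GrpRing p m →ₗ[(GrpRing p m)ᵐᵒᵖ] RowHat p n :=
    { toFun := fun a => MulOpposite.op a • r'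
      map_add' := fun a b => by rw [MulOpposite.op_add, add_smul]
      map_smul' := fun a b => by
        rw [RingHom.id_apply, ← mul_smul]
        rfl }
  refine ⟨g, fun t => ?_⟩
  obtain ⟨b, hb⟩ := exists_genX_sub_one_mul (show toCyc p m (j t) = 0 from (hj.2.1 (j t)).2 ⟨t, rfl⟩)
  have ht : t = MulOpposite.op b • t₀ := by
    apply hj.1
    rw [map_smul, ht₀, ← hb]
    rfl
  have hr' : MulOpposite.op (genX p m - 1) • r' = d t₀ := funext hr
  change d t = MulOpposite.op (j t) • r'
  rw [← hb, MulOpposite.op_mul, mul_smul, hr', ht, map_smul]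

end Kernel

/-! ### Integral matrices acting on the sum of the rows. -/

section RowMatrix

variable {p : ℕ}

/-- The endomorphism of `R(1) ⊕ ⋯ ⊕ R(p - 1)` given by an integral matrix which is diagonal
mod `p`. -/
def rowMatrix [Fact p.Prime] (m : (ZMod p)ˣ) (A : Matrix (Fin (p - 1)) (Fin (p - 1)) ℤ)
    (hA : ∀ a b, a ≠ b → (p : ℤ) ∣ A a b) :
    RowSum p →ₗ[(GrpRing p m)ᵐᵒᵖ] RowSum p where
  toFun v a := ⟨∑ b, A a b • (v b).1, fun k hk => by
    rw [Finset.sum_apply]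
    refine Finset.dvd_sum fun b _ => ?_
    by_cases hab : a = b
    · subst hab
      exact Dvd.dvd.mul_left ((v a).2 k hk) _
    -- Different rows are not contained in each other both ways, but `p ℤ^(p-1)` lies in every row.
    · exact Dvd.dvd.mul_right (hA a b hab) _⟩
  map_add' v w := by
    ext a k
    simp [Finset.sum_add_distrib]
  map_smul' c v := by
    refine funext fun a => Subtype.ext ?_
    change ∑ b, A a b • Matrix.vecMul (v b).1 (lam p m c.unop).1
      = Matrix.vecMul (∑ b, A a b • (v b).1) (lam p m c.unop).1
    rw [Matrix.sum_vecMul]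
    exact Finset.sum_congr rfl fun b _ => (Matrix.smul_vecMul _ _ _).symm

variable [Fact p.Prime] {m : (ZMod p)ˣ}

lemma rowMatrix_apply {A : Matrix (Fin (p - 1)) (Fin (p - 1)) ℤ}
    (hA : ∀ a b, a ≠ b → (p : ℤ) ∣ A a b) (v : RowSum p) (a k : Fin (p - 1)) :
    (rowMatrix m A hA v a).1 k = ∑ b, A a b * (v b).1 k := by
  simp [rowMatrix]

lemma rowMatrix_rowMatrix {A B : Matrix (Fin (p - 1)) (Fin (p - 1)) ℤ}
    (hA : ∀ a b, a ≠ b → (p : ℤ) ∣ A a b) (hB : ∀ a b, a ≠ b → (p : ℤ) ∣ B a b)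
    (h : A * B = 1) (v : RowSum p) : rowMatrix m A hA (rowMatrix m B hB v) = v := by
  refine funext fun a => Subtype.ext (funext fun k => ?_)
  have h1 : ∀ A' hA' (w : RowSum p), (fun a => (rowMatrix m A' hA' w a).1 k)
      = Matrix.mulVec A' fun b => (w b).1 k := fun A' hA' w =>
    funext fun a => rowMatrix_apply hA' w a k
  have h2 := h1 A hA (rowMatrix m B hB v)
  rw [h1 B hB v, Matrix.mulVec_mulVec, h, Matrix.one_mulVec] at h2
  exact congrFun h2 a

end RowMatrix

/-! ### The projection to `R(n̂)` and comparison of maps by `k`-invariants. -/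

section Projection

variable {p : ℕ} [Fact p.Prime] (m : (ZMod p)ˣ) (n : Fin (p - 1))

/-- The projection of `R(1) ⊕ ⋯ ⊕ R(p - 1)` onto `R(n̂)`. -/
def projHat : RowSum p →ₗ[(GrpRing p m)ᵐᵒᵖ] RowHat p n :=
  LinearMap.pi fun i => LinearMap.proj i.1

lemma projHat_surjective : Function.Surjective (projHat m n) := fun w =>
  ⟨fun i => if h : i ≠ n then w ⟨i, h⟩ else 0, funext fun i => dif_pos i.2⟩

lemma ker_projHat : LinearMap.ker (projHat m n)
    = LinearMap.range (LinearMap.single (GrpRing p m)ᵐᵒᵖ (fun i => Row p i) n) := by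
  ext v
  constructor
  · intro hv
    refine ⟨v n, funext fun i => ?_⟩
    by_cases hi : i = n
    · subst hi; simp
    · have : v i = 0 := congrFun (LinearMap.mem_ker.1 hv) ⟨i, hi⟩
      rw [this, LinearMap.single_apply, Pi.single_eq_of_ne hi]
  · rintro ⟨w, rfl⟩
    exact LinearMap.mem_ker.2
      (funext fun i => Pi.single_eq_of_ne (M := fun i => Row p i) i.2 w)

end Projection

/-- A homomorphism `R(1) ⊕ ⋯ ⊕ R(p - 1) → R(n̂)` is determined mod `p` by its `k`-invariants, on
the coordinates that obstruct extension to `Λ`. -/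
lemma dvd_apply_sub_kInvariant {p : ℕ} [Fact p.Prime] (hp : p ≠ 2) {m : (ZMod p)ˣ}
    (hm : orderOf m = p - 1) {n : Fin (p - 1)} (f : RowSum p →ₗ[(GrpRing p m)ᵐᵒᵖ] RowHat p n)
    (i : {i : Fin (p - 1) // i ≠ n}) (v : RowSum p) :
    (p : ℤ) ∣ (f v i).1 i.1 - (f (Pi.single i.1 (rowGen p i.1)) i).1 i.1 * (v i.1).1 i.1 := by
  let h : ∀ b, Row p b →ₗ[(GrpRing p m)ᵐᵒᵖ] Row p i.1 := fun b =>
    LinearMap.proj i ∘ₗ f ∘ₗ LinearMap.single (GrpRing p m)ᵐᵒᵖ (fun i => Row p i) b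
  have hv : (f v i).1 i.1 = ∑ b, (h b (v b)).1 i.1 := by
    have h1 : f v i = ∑ b, h b (v b) := by
      conv_lhs => rw [← Finset.univ_sum_single v, map_sum, Finset.sum_apply]
      rfl
    rw [h1, AddSubgroup.val_finsetSum, Finset.sum_apply]
  rw [hv, ← Finset.add_sum_erase _ _ (Finset.mem_univ i.1), add_sub_right_comm]
  refine dvd_add ?_ (Finset.dvd_sum fun b hb =>
    dvd_hom_apply_of_ne (h b) hp hm (Finset.ne_of_mem_erase hb).symm _)
  have := dvd_hom_apply_sub (h i.1) (v i.1)
  rwa [mul_comm] at this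

end Metacyclic

end

theorem mainTheorem7 (p : ℕ) [Fact p.Prime] (hp : p ≠ 2) (m : (ZMod p)ˣ) (hm : orderOf m = p - 1)
    (n : Fin (p - 1)) (K : Type*) [AddCommGroup K] [Module (Metacyclic.GrpRing p m)ᵐᵒᵖ K]
    (ι : Metacyclic.RowHat p n →ₗ[(Metacyclic.GrpRing p m)ᵐᵒᵖ] K)
    (q : K →ₗ[(Metacyclic.GrpRing p m)ᵐᵒᵖ] MonoidAlgebra ℤ (Metacyclic.CycQ p))
    (hK : Metacyclic.IsShortExact ι q) (hk : Metacyclic.HasNonzeroKInvariants ι q) :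
    ∃ i : Metacyclic.Row p n →ₗ[(Metacyclic.GrpRing p m)ᵐᵒᵖ] Metacyclic.GrpRing p m,
      Function.Injective i ∧
        Nonempty (K ≃ₗ[(Metacyclic.GrpRing p m)ᵐᵒᵖ] Metacyclic.GrpRing p m ⧸ LinearMap.range i) := by
  open Metacyclic in
  obtain ⟨j, f, hj, ⟨e, -, -⟩, hf⟩ := hk
  -- The value `0` at `n` is a dummy: the lift leaves that diagonal entry unconstrained.
  let c : Fin (p - 1) → ℤ := fun i =>
    if h : i ≠ n then (f (Pi.single i (rowGen p i)) ⟨i, h⟩).1 i else 0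
  have hc : ∀ i : {i : Fin (p - 1) // i ≠ n},
      c i.1 = (f (Pi.single i.1 (rowGen p i.1)) i).1 i.1 := fun i => dif_pos i.2
  obtain ⟨A, B, hAB, hBA, hA, hAc⟩ := exists_matrix_lift (p := p) n c fun i hi hdvd =>
    hf ⟨i, hi⟩ ((ZMod.intCast_zmod_eq_zero_iff_dvd _ p).2 (hc ⟨i, hi⟩ ▸ hdvd))
  have hB : ∀ a b, a ≠ b → (p : ℤ) ∣ B a b := fun a b => dvd_of_mul_eq_one hAB hA
  let F : RowSum p ≃ₗ[(GrpRing p m)ᵐᵒᵖ] RowSum p :=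
    { rowMatrix m A hA with
      invFun := rowMatrix m B hB
      left_inv := rowMatrix_rowMatrix hB hA hBA
      right_inv := rowMatrix_rowMatrix hA hB hAB }
  let f' : RowSum p →ₗ[(GrpRing p m)ᵐᵒᵖ] RowHat p n := projHat m n ∘ₗ F.toLinearMap
  obtain ⟨g, hg⟩ := exists_extension hj (f - f') fun v i => by
    have h1 := dvd_apply_sub_kInvariant hp hm f i v
    have h2 : (p : ℤ) ∣ (f' v i).1 i.1 - c i.1 * (v i.1).1 i.1 := by
      have h3 : (f' v i).1 i.1 = ∑ b, A i.1 b * (v b).1 i.1 := rowMatrix_apply (m := m) hA v i.1 i.1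
      rw [h3, ← Finset.add_sum_erase _ _ (Finset.mem_univ i.1), add_sub_right_comm, ← sub_mul]
      exact dvd_add ((hAc i.1 i.2).mul_right _) (Finset.dvd_sum fun b hb =>
        (hA i.1 b (Finset.ne_of_mem_erase hb).symm).mul_right _)
    rw [hc] at h2
    have := dvd_sub h1 h2
    rwa [sub_sub_sub_cancel_right] at this
  obtain ⟨e'⟩ := nonempty_pushout_equiv (f := f) (f' := f') (g := g) (j := j)
    (fun t => by rw [← hg]; simp) ((projHat_surjective m n).comp F.surjective)
  let s := LinearMap.single (GrpRing p m)ᵐᵒᵖ (fun i => Row p i) n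
  -- The kernel of the projection is `R(n)`, so that of `f'` is its preimage under the automorphism
  -- `F`.
  have hker : (LinearMap.ker f').map j = LinearMap.range (j ∘ₗ F.symm.toLinearMap ∘ₗ s) := by
    rw [LinearMap.range_comp, LinearMap.range_comp, ← ker_projHat, LinearMap.ker_comp]
    congr 1
    ext v
    constructor
    · exact fun hv => ⟨F v, hv, F.symm_apply_apply v⟩
    · rintro ⟨w, hw, rfl⟩
      simpa using hw
  exact ⟨j ∘ₗ F.symm.toLinearMap ∘ₗ s,
    hj.1.comp (F.symm.injective.comp (Pi.single_injective (M := fun i => Row p i) n)),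
    ⟨e.symm.trans (e'.trans (Submodule.quotEquivOfEq _ _ hker))⟩⟩
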